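/- Consider a network with one server, $K_1$ mirror sites and $K_2$ users attached to each mirror site, and a library of $N\ge K_1K_2$ files of $B$ bits each. A scheme with uncoded placement divides each file into $F$ packets of $B/F\ge 1$ bits ($F\mid B$). Before the demands are known, each mirror site stores at most $M_1F$ packets and each user at most $M_2F$ packets of the library. For a demand vector $\mathbf d\in[N]^{K_1K_2}$ (one requested file per user) the server, which knows all files, broadcasts $S(\mathbf d)$ packets to the mirror sites; each mirror site broadcasts to its $K_2$ users a message that is a function of the server's message, its own cache and $\mathbf d$; and each user must recover its requested file without error from its mirror site's message and its own cache. Let $D\subseteq[N]^{K_1K_2}$ be a set of demand vectors to be served that contains all demand vectors with pairwise distinct entries (for instance $D=[N]^{K_1K_2}$, or only the vectors with distinct entries). The first-layer load of a scheme that serves $D$ is $R_1=\max_{\mathbf d\in D}S(\mathbf d)/F$, and $R_1^*$ is the infimum of $R_1$ over all file sizes $B\ge1$ and all such schemes. Let $K_1,K_2,t$ be positive integers with $K_2<t<K_1K_2$ and suppose that $$\frac{M_1}{N}=\frac{\binom{K_1K_2-K_2}{t-K_2}}{\binom{K_1K_2}{t}},\qquad \frac{M_2}{N}=\frac{t}{K_1K_2}-\frac{\binom{K_1K_2-K_2}{t-K_2}}{\binom{K_1K_2}{t}}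 .$$ Then the first-layer load $\frac{K_1K_2-t}{t+1}$ is optimal under uncoded placement: it is attained by some scheme, no scheme has a smaller first-layer load, and $$R_1^*=\frac{K_1K_2\left(1-\frac{M_1+M_2}{N}\right)}{K_1K_2\,\frac{M_1+M_2}{N}+1}.$$ Moreover, it is the minimum of the first-layer loads for every fixed file size $B\ge1$ that is divisible by $\binom{K_1K_2}{t}$. -/

import Mathlib

namespace HierCaching

/-- A packet of `b` bits. -/
abbrev Packet (b : ℕ) : Type := Fin b → ZMod 2

/-- A library of `N` files, each one cut into `F` packets of `b` bits (so a file has `F * b` bits). -/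
abbrev Library (N F b : ℕ) : Type := Fin N × Fin F → Packet b

/-- A demand vector: user `(k₁, k₂)`, the `k₂`-th user of mirror site `k₁`, requests one file. -/
abbrev Demand (K₁ K₂ N : ℕ) : Type := Fin K₁ × Fin K₂ → Fin N

/-- What a node that stores the packets with index in `Z` sees of the library `W`. -/
def cached {N F b : ℕ} (W : Library N F b) (Z : Finset (Fin N × Fin F)) : Z → Packet b :=
  fun p => W p

/-- A coded caching scheme with uncoded placement for the two-layer network of one server,
`K₁` mirror sites and `K₂` users at every mirror site, with `N` files of `F` packets of `b` bits.
The placement (which packets are stored where) does not depend on the demand. All delivery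
functions may depend on the demand and are otherwise arbitrary. -/
structure Scheme (K₁ K₂ N F b : ℕ) where
  /-- indices of the packets stored by each mirror site -/
  mirrorCache : Fin K₁ → Finset (Fin N × Fin F)
  /-- indices of the packets stored by each user -/
  userCache : Fin K₁ × Fin K₂ → Finset (Fin N × Fin F)
  /-- number of packets broadcast by the server to the mirror sites -/
  serverLen : Demand K₁ K₂ N → ℕ
  /-- the message of the server, a function of the library -/
  serverMsg : (d : Demand K₁ K₂ N) → Library N F b → (Fin (serverLen d) → Packet b)
  /-- number of packets broadcast by a mirror site to its users -/
  mirrorLen : Demand K₁ K₂ N → Fin K₁ → ℕ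
  /-- the message of a mirror site, a function of the server's message and of its own cache -/
  mirrorMsg : (d : Demand K₁ K₂ N) → (k : Fin K₁) →
    (Fin (serverLen d) → Packet b) → (mirrorCache k → Packet b) →
      (Fin (mirrorLen d k) → Packet b)
  /-- the decoder of a user, applied to the message of its mirror site and to its own cache -/
  decode : (d : Demand K₁ K₂ N) → (u : Fin K₁ × Fin K₂) →
    (Fin (mirrorLen d u.1) → Packet b) → (userCache u → Packet b) → (Fin F → Packet b)

namespace Scheme

variable {K₁ K₂ N F b : ℕ}

/-- Every mirror site stores at most `M₁` files and every user at most `M₂` files,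
measured in units of one file, that is, of `F` packets. -/
def FitsMemory (c : Scheme K₁ K₂ N F b) (M₁ M₂ : ℝ) : Prop :=
  (∀ k, ((c.mirrorCache k).card : ℝ) ≤ M₁ * F) ∧ (∀ u, ((c.userCache u).card : ℝ) ≤ M₂ * F)

/-- For the demand `d`, every user recovers all packets of its requested file,
whatever the contents of the library. -/
def Serves (c : Scheme K₁ K₂ N F b) (d : Demand K₁ K₂ N) : Prop :=
  ∀ (W : Library N F b) (u : Fin K₁ × Fin K₂) (j : Fin F),
    c.decode d u
      (c.mirrorMsg d u.1 (c.serverMsg d W) (cached W (c.mirrorCache u.1)))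
      (cached W (c.userCache u)) j = W (d u, j)

/-- `R` is the first-layer load of the scheme: the maximum, over the demand vectors in `D`,
of the number of packets sent by the server, in units of one file. -/
def IsFirstLayerLoad (c : Scheme K₁ K₂ N F b) (D : Set (Demand K₁ K₂ N)) (R : ℝ) : Prop :=
  IsGreatest ((fun d => (c.serverLen d : ℝ) / F) '' D) R

end Scheme

/-- The first-layer loads of all schemes with uncoded placement for files of `B` bits, with
memory sizes `M₁` and `M₂`, that serve all the demand vectors in `D`.
The number `F` of packets per file is arbitrary among the positive divisors of `B`. -/
def firstLayerLoads (K₁ K₂ N : ℕ) (M₁ M₂ : ℝ) (D : Set (Demand K₁ K₂ N)) (B : ℕ) : Set ℝ :=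
  {R | ∃ F b : ℕ, 0 < F ∧ 0 < b ∧ F * b = B ∧ ∃ c : Scheme K₁ K₂ N F b,
    c.FitsMemory M₁ M₂ ∧ (∀ d ∈ D, c.Serves d) ∧ c.IsFirstLayerLoad D R}

/-- The optimal first-layer load under uncoded placement, over all file sizes and all schemes. -/
noncomputable def optimalFirstLayerLoad (K₁ K₂ N : ℕ) (M₁ M₂ : ℝ)
    (D : Set (Demand K₁ K₂ N)) : ℝ :=
  sInf (⋃ B : ℕ, firstLayerLoads K₁ K₂ N M₁ M₂ D B)

end HierCaching

/-! The second-layer load is unconstrained, so a mirror site may forward its whole cache, and each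
user in effect has a cache of `M₁ + M₂ = t * N / K` files, where `K = K₁ * K₂`. The problem becomes
single-layer coded caching with `K` users. Converse: for distinct demands and any order of the
users, the server must send every requested packet that all its holders come after the requester
(`card_le_serverLen`). Averaged over orders and cyclically shifted demands, a packet with `s`
holders contributes `(K - s) / (s + 1)`. This is convex in `s`, and the mean of `s` is at most `t`,
so the load is at least `(K - t) / (t + 1)` (`load_ge`). Achievability: packets are labelled by
`t`-subsets of the users. The mirror site stores the labels containing all its users, and a user
stores the other labels containing it, so nothing is stored twice along a path. Multicasts indexed
by `(t + 1)`-subsets then meet the bound. -/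

namespace HierCaching

open Finset

/-! ### Random orders and convexity -/

/-- In a uniformly random order of `U`, the point `u` precedes all points of `T` with
probability `1 / (#T + 1)`. -/
theorem card_orders_precede {U : Type*} [Fintype U] [DecidableEq U] {n : ℕ} (T : Finset U) (u : U)
    (hu : u ∉ T) :
    (#T + 1) * #{π : U ≃ Fin n | ∀ v ∈ T, π u < π v} = Fintype.card (U ≃ Fin n) := by
  set I := insert u T with hI
  have hcard : #I = #T + 1 := card_insert_of_notMem hu
  -- By symmetry, each point of `I` is equally often the first: transposing `u` and `w` preserves
  -- `I`.
  have hA : ∀ w ∈ I, #{π : U ≃ Fin n | ∀ v ∈ I, π w ≤ π v} =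
      #{π : U ≃ Fin n | ∀ v ∈ T, π u < π v} := by
    intro w hw
    have hmem : ∀ v, v ∈ I → Equiv.swap u w v ∈ I := by
      intro v hv
      rw [Equiv.swap_apply_def]
      split_ifs
      · exact hw
      · exact mem_insert_self u T
      · exact hv
    have huI : u ∈ I := mem_insert_self u T
    refine card_bij' (fun π _ => (Equiv.swap u w).trans π)
      (fun π _ => (Equiv.swap u w).trans π) ?_ ?_ ?_ ?_
    · intro π hπ
      simp only [mem_filter, mem_univ, true_and, Equiv.trans_apply, Equiv.swap_apply_left] at hπ ⊢
      intro v hv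
      have h1 := hπ _ (hmem v (mem_insert_of_mem hv))
      refine lt_of_le_of_ne h1 fun h => ?_
      have h2 := π.injective h
      rw [eq_comm, Equiv.swap_apply_eq_iff, Equiv.swap_apply_right] at h2
      exact hu (h2 ▸ hv)
    · intro π hπ
      simp only [mem_filter, mem_univ, true_and, Equiv.trans_apply, Equiv.swap_apply_right] at hπ ⊢
      intro v hv
      rcases mem_insert.1 (hmem v hv) with h | h
      · rw [h]
      · exact (hπ _ h).le
    · intro π _
      ext x
      simp
    · intro π _
      ext x
      simp
  have hsum : ∑ w ∈ I, #{π : U ≃ Fin n | ∀ v ∈ I, π w ≤ π v} = Fintype.card (U ≃ Fin n) := by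
    simp only [card_filter]
    rw [sum_comm, ← card_univ, card_eq_sum_ones]
    refine sum_congr rfl fun π _ => ?_
    obtain ⟨w, hw, hmin⟩ := exists_min_image I π ⟨u, mem_insert_self u T⟩
    rw [sum_eq_single_of_mem w hw, if_pos hmin]
    intro x hx hxw
    refine if_neg fun h => hxw (π.injective (le_antisymm (h w hw) (hmin x hx)))
  rw [← hsum, sum_congr rfl hA, sum_const, hcard, smul_eq_mul]

/-- The expected number of points of `U` that precede all points of `T` in a random order. -/
theorem sum_card_orders_precede {U : Type*} [Fintype U] [DecidableEq U] {n : ℕ} (T : Finset U) :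
    (∑ u : U, (#{π : U ≃ Fin n | ∀ v ∈ T, π u < π v} : ℝ)) =
      Fintype.card (U ≃ Fin n) * (((Fintype.card U : ℝ) - #T) / (#T + 1)) := by
  rw [← sum_add_sum_compl T]
  have h0 : ∑ u ∈ T, (#{π : U ≃ Fin n | ∀ v ∈ T, π u < π v} : ℝ) = 0 := by
    refine sum_eq_zero fun u hu => ?_
    rw [Nat.cast_eq_zero, card_eq_zero, filter_eq_empty_iff]
    exact fun π _ h => lt_irrefl _ (h u hu)
  have h1 : ∀ u ∈ Tᶜ, (#{π : U ≃ Fin n | ∀ v ∈ T, π u < π v} : ℝ) =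
      Fintype.card (U ≃ Fin n) / ((#T : ℝ) + 1) := by
    intro u hu
    rw [eq_div_iff (by positivity), ← card_orders_precede T u (mem_compl.1 hu)]
    push_cast
    ring
  rw [h0, zero_add, sum_congr rfl h1, sum_const, card_compl, nsmul_eq_mul,
    Nat.cast_sub (card_le_univ T)]
  ring

/-- The convex function `(K - s) / (s + 1)` lies above its tangent at `t`. -/
theorem tangent_le {K s t : ℝ} (hK : 0 ≤ K) (hs : 0 ≤ s) (ht : 0 ≤ t) :
    (K - t) / (t + 1) - (K + 1) / (t + 1) ^ 2 * (s - t) ≤ (K - s) / (s + 1) := by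
  have h : (K - s) / (s + 1) - ((K - t) / (t + 1) - (K + 1) / (t + 1) ^ 2 * (s - t)) =
      (K + 1) * (s - t) ^ 2 / ((s + 1) * (t + 1) ^ 2) := by
    field_simp
    ring
  have h' : 0 ≤ (K + 1) * (s - t) ^ 2 / ((s + 1) * (t + 1) ^ 2) := by positivity
  linarith

/-! ### The converse bound -/

namespace Scheme

variable {K₁ K₂ N F b : ℕ}

/-- The packets available to a user from its own cache and from the cache of its mirror site. -/
def reachable (c : Scheme K₁ K₂ N F b) (u : Fin K₁ × Fin K₂) : Finset (Fin N × Fin F) :=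
  c.mirrorCache u.1 ∪ c.userCache u

/-- The acyclic index coding bound: for distinct demands and any order of the users, the server
sends at least as many packets as there are requested packets that are not reachable for the
requesting user and all users before it. -/
theorem card_le_serverLen (c : Scheme K₁ K₂ N F b) (hb : 0 < b) {d : Demand K₁ K₂ N}
    (hd : Function.Injective d) (hc : c.Serves d) {n : ℕ} (π : Fin K₁ × Fin K₂ ≃ Fin n) :
    #{q : (Fin K₁ × Fin K₂) × Fin F | ∀ v, (d q.1, q.2) ∈ c.reachable v → π q.1 < π v} ≤
      c.serverLen d := by
  set P : Finset ((Fin K₁ × Fin K₂) × Fin F) :=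
    {q | ∀ v, (d q.1, q.2) ∈ c.reachable v → π q.1 < π v} with hP
  let ι : P → Fin N × Fin F := fun q => (d q.1.1, q.1.2)
  have hι : Function.Injective ι := by
    rintro ⟨⟨u, i⟩, hq⟩ ⟨⟨v, j⟩, hr⟩ h
    simp only [ι, Prod.mk.injEq] at h
    obtain ⟨h1, rfl⟩ := h
    obtain rfl := hd h1
    rfl
  -- Only the packets in `P` vary; all others are zero and hence known to every user.
  let L : (P → Packet b) → Library N F b := fun f => Function.extend ι f 0
  have hinj : Function.Injective fun f => c.serverMsg d (L f) := by
    intro f g hfg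
    -- Users are decoded in the order `π`: a varying packet reachable for `u` was requested by an
    -- earlier user, so it is already determined.
    have hdec : ∀ (m : ℕ) (u : Fin K₁ × Fin K₂), (π u : ℕ) = m → ∀ j,
        L f (d u, j) = L g (d u, j) := by
      intro m
      induction m using Nat.strong_induction_on with
      | _ m ih =>
        intro u hu j
        have hreach : ∀ p ∈ c.reachable u, L f p = L g p := by
          intro p hp
          by_cases hpP : ∃ q, ι q = p
          · obtain ⟨q, rfl⟩ := hpP
            have hq := (mem_filter.1 q.2).2 u hp
            exact ih _ (hu ▸ hq) _ rfl _
          · simp only [L, Function.extend_apply' _ _ _ hpP]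
        have h1 : cached (L f) (c.mirrorCache u.1) = cached (L g) (c.mirrorCache u.1) :=
          funext fun p => hreach p (mem_union_left _ p.2)
        have h2 : cached (L f) (c.userCache u) = cached (L g) (c.userCache u) :=
          funext fun p => hreach p (mem_union_right _ p.2)
        have hfg' : c.serverMsg d (L f) = c.serverMsg d (L g) := hfg
        rw [← hc (L f) u j, ← hc (L g) u j, h1, h2, hfg']
    funext q
    have h := hdec _ q.1.1 rfl q.1.2
    change Function.extend ι f 0 (ι q) = Function.extend ι g 0 (ι q) at h
    rwa [hι.extend_apply, hι.extend_apply] at h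
  have hcard := Fintype.card_le_of_injective _ hinj
  simp only [Fintype.card_fun, Fintype.card_fin, Fintype.card_coe, ZMod.card] at hcard
  rw [← pow_mul, ← pow_mul] at hcard
  exact Nat.le_of_mul_le_mul_left ((Nat.pow_le_pow_iff_right one_lt_two).1 hcard) hb

/-- The converse bound for a scheme in which every user reaches at most the fraction
`t / (K₁ * K₂)` of the library. -/
theorem load_ge (c : Scheme K₁ K₂ N F b) (hb : 0 < b) (hF : 0 < F) (hK : 0 < K₁ * K₂)
    (hN : K₁ * K₂ ≤ N) {t R : ℝ} (ht : 0 ≤ t)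
    (hmem : ∀ u, (#(c.reachable u) : ℝ) ≤ t / (K₁ * K₂) * (N * F))
    (hserve : ∀ d : Demand K₁ K₂ N, Function.Injective d → c.Serves d)
    (hR : ∀ d : Demand K₁ K₂ N, Function.Injective d → (c.serverLen d : ℝ) ≤ R * F) :
    ((K₁ : ℝ) * K₂ - t) / (t + 1) ≤ R := by
  have hN0 : 0 < N := hK.trans_le hN
  -- Provides the cyclic addition on `Fin N` that shifts demands.
  have : NeZero N := ⟨hN0.ne'⟩
  obtain ⟨d₀⟩ : Nonempty (Fin K₁ × Fin K₂ ↪ Fin N) :=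
    Function.Embedding.nonempty_of_card_le (by simpa using hN)
  let holders : Fin N × Fin F → Finset (Fin K₁ × Fin K₂) := fun p => {v | p ∈ c.reachable v}
  let Ord := Fin K₁ × Fin K₂ ≃ Fin (K₁ * K₂)
  have hOrd : (0 : ℝ) < Fintype.card Ord := by
    have : Nonempty Ord := ⟨finProdFinEquiv⟩
    exact_mod_cast Fintype.card_pos
  -- Over all shifts `a`, each user requests each file exactly once, so the sum regroups by packets.
  have hcount : ∑ a : Fin N, ∑ π : Ord,
      (#{q : (Fin K₁ × Fin K₂) × Fin F |
        ∀ v, (a + d₀ q.1, q.2) ∈ c.reachable v → π q.1 < π v} : ℝ) =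
      ∑ p : Fin N × Fin F, Fintype.card Ord *
        (((K₁ : ℝ) * K₂ - #(holders p)) / (#(holders p) + 1)) := by
    have hcardU : ((Fintype.card (Fin K₁ × Fin K₂) : ℕ) : ℝ) = (K₁ : ℝ) * K₂ := by simp
    have hprec : ∀ p, (Fintype.card Ord : ℝ) *
        (((K₁ : ℝ) * K₂ - #(holders p)) / (#(holders p) + 1)) =
        ∑ u, (#{π : Ord | ∀ v ∈ holders p, π u < π v} : ℝ) :=
      fun p => by rw [sum_card_orders_precede, hcardU]
    simp_rw [hprec, card_filter]
    push_cast
    have hsplit : ∀ f : (Fin K₁ × Fin K₂) × Fin F → ℝ, ∑ q, f q = ∑ u, ∑ j, f (u, j) :=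
      fun f => Fintype.sum_prod_type f
    have hsplit' : ∀ f : Fin N × Fin F → ℝ, ∑ q, f q = ∑ a, ∑ j, f (a, j) :=
      fun f => Fintype.sum_prod_type f
    simp_rw [hsplit, hsplit']
    have hsh : ∀ (u : Fin K₁ × Fin K₂) (g : Fin N → ℝ), ∑ a, g (a + d₀ u) = ∑ a, g a :=
      fun u g => Equiv.sum_comp (Equiv.addRight (d₀ u)) g
    calc _ = ∑ u : Fin K₁ × Fin K₂, ∑ j : Fin F, ∑ a : Fin N, ∑ π : Ord,
          (if ∀ v, (a + d₀ u, j) ∈ c.reachable v → π u < π v then (1 : ℝ) else 0) := by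
          simp_rw [sum_comm (s := (univ : Finset Ord))]
          rw [sum_comm]
          refine sum_congr rfl fun u _ => ?_
          rw [sum_comm]
      _ = ∑ u : Fin K₁ × Fin K₂, ∑ j : Fin F, ∑ a : Fin N, ∑ π : Ord,
          (if ∀ v, (a, j) ∈ c.reachable v → π u < π v then (1 : ℝ) else 0) := by
          refine sum_congr rfl fun u _ => sum_congr rfl fun j _ => ?_
          exact hsh u fun a => ∑ π : Ord,
            (if ∀ v, (a, j) ∈ c.reachable v → π u < π v then (1 : ℝ) else 0)
      _ = _ := by
          simp only [holders, mem_filter, mem_univ, true_and]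
          rw [sum_comm, sum_comm (s := (univ : Finset (Fin N)))]
          refine sum_congr rfl fun j _ => ?_
          rw [sum_comm]
  have hupper : ∑ a : Fin N, ∑ π : Ord,
      (#{q : (Fin K₁ × Fin K₂) × Fin F |
        ∀ v, (a + d₀ q.1, q.2) ∈ c.reachable v → π q.1 < π v} : ℝ) ≤
      ∑ _a : Fin N, ∑ _π : Ord, R * F := by
    refine sum_le_sum fun a _ => sum_le_sum fun π _ => ?_
    have hinj : Function.Injective fun u => a + d₀ u := (add_right_injective a).comp d₀.injective
    exact (Nat.cast_le.2 (c.card_le_serverLen hb hinj (hserve _ hinj) π)).trans (hR _ hinj)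
  have hholders : ∑ p, (#(holders p) : ℝ) ≤ t * (N * F) := by
    have hswap : ∑ p, (#(holders p) : ℝ) = ∑ u, (#(c.reachable u) : ℝ) := by
      have := sum_card_bipartiteAbove_eq_sum_card_bipartiteBelow
        (s := (univ : Finset (Fin N × Fin F))) (t := (univ : Finset (Fin K₁ × Fin K₂)))
        (fun p v => p ∈ c.reachable v)
      simp only [bipartiteAbove, bipartiteBelow, filter_mem_eq_inter, univ_inter] at this
      exact_mod_cast this
    rw [hswap]
    refine (sum_le_sum fun u _ => hmem u).trans_eq ?_
    have hK' : (K₁ : ℝ) * K₂ ≠ 0 := by exact_mod_cast hK.ne'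
    rw [sum_const, card_univ, Fintype.card_prod, Fintype.card_fin, Fintype.card_fin, nsmul_eq_mul]
    push_cast
    rw [← mul_assoc, mul_div_cancel₀ _ hK']
  have hlower : ∑ p : Fin N × Fin F, Fintype.card Ord *
      (((K₁ : ℝ) * K₂ - t) / (t + 1) - ((K₁ : ℝ) * K₂ + 1) / (t + 1) ^ 2 * (#(holders p) - t)) ≤
      ∑ _a : Fin N, ∑ _π : Ord, R * F := by
    refine le_trans (sum_le_sum fun p _ => ?_) (hcount.symm.trans_le hupper)
    exact mul_le_mul_of_nonneg_left (tangent_le (by positivity) (by positivity) ht) hOrd.le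
  rw [← mul_sum, sum_sub_distrib, ← mul_sum, sum_sub_distrib] at hlower
  simp only [sum_const, card_univ, Fintype.card_prod, Fintype.card_fin, nsmul_eq_mul,
    Nat.cast_mul] at hlower
  have hNF : (0 : ℝ) < N * F := by positivity
  -- The tangent slopes downwards, so an upper bound on the total number of holders suffices.
  have hslope : ((K₁ : ℝ) * K₂ + 1) / (t + 1) ^ 2 *
      (∑ p, (#(holders p) : ℝ) - N * F * t) ≤ 0 :=
    mul_nonpos_of_nonneg_of_nonpos (by positivity) (by linarith)
  have h1 : (Fintype.card Ord : ℝ) * (N * F * (((K₁ : ℝ) * K₂ - t) / (t + 1))) ≤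
      Fintype.card Ord * (N * F * R) := by
    refine le_trans (mul_le_mul_of_nonneg_left ?_ hOrd.le) (hlower.trans_eq (by ring))
    linarith
  exact le_of_mul_le_mul_left (le_of_mul_le_mul_left h1 hOrd) hNF

/-! ### Forwarding schemes -/

/-- The scheme with given placement and server messages in which every mirror site forwards the
server's message together with its own cache. -/
noncomputable def forwarding (mirrorCache : Fin K₁ → Finset (Fin N × Fin F))
    (userCache : Fin K₁ × Fin K₂ → Finset (Fin N × Fin F)) (S : ℕ)
    (serverMsg : Demand K₁ K₂ N → Library N F b → (Fin S → Packet b)) :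
    Scheme K₁ K₂ N F b where
  mirrorCache := mirrorCache
  userCache := userCache
  serverLen _ := S
  serverMsg := serverMsg
  mirrorLen _ k := S + #(mirrorCache k)
  mirrorMsg _ k X Y := Fin.append X (Y ∘ (mirrorCache k).equivFin.symm)
  -- The decoder inverts the observation of the user; the default zero only matters on inputs that
  -- never occur.
  decode d u Y Z := Function.extend
    (fun W : Library N F b =>
      (Fin.append (serverMsg d W) (cached W (mirrorCache u.1) ∘ (mirrorCache u.1).equivFin.symm),
        cached W (userCache u)))
    (fun W j => W (d u, j)) (fun _ => 0) (Y, Z)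

/-- The forwarding scheme serves a demand if the server's message and the reachable packets of
a user determine its requested file. -/
theorem forwarding_serves (mirrorCache : Fin K₁ → Finset (Fin N × Fin F))
    (userCache : Fin K₁ × Fin K₂ → Finset (Fin N × Fin F)) (S : ℕ)
    (serverMsg : Demand K₁ K₂ N → Library N F b → (Fin S → Packet b)) (d : Demand K₁ K₂ N)
    (h : ∀ (u : Fin K₁ × Fin K₂) (W W' : Library N F b), serverMsg d W = serverMsg d W' →
      (∀ p ∈ mirrorCache u.1 ∪ userCache u, W p = W' p) → ∀ j, W (d u, j) = W' (d u, j)) :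
    (forwarding mirrorCache userCache S serverMsg).Serves d := by
  intro W u j
  refine congrFun (Function.FactorsThrough.extend_apply (g := fun W j => W (d u, j))
    (f := fun W : Library N F b =>
      (Fin.append (serverMsg d W) (cached W (mirrorCache u.1) ∘ (mirrorCache u.1).equivFin.symm),
        cached W (userCache u))) ?_ (fun _ => 0) W) j
  intro W W' hW
  obtain ⟨h1, h2⟩ := Prod.mk.inj hW
  refine funext fun j => h u W W' ?_ ?_ j
  · funext i
    simpa using congrFun h1 (Fin.castAdd _ i)
  · intro p hp
    rcases mem_union.1 hp with hp | hp
    · simpa [cached] using congrFun h1 (Fin.natAdd _ ((mirrorCache u.1).equivFin ⟨p, hp⟩))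
    · exact congrFun h2 ⟨p, hp⟩

end Scheme

/-! ### Placement by subsets and multicast delivery -/

/-- The number of `t`-subsets that contain a given set. -/
theorem card_superset_powersetCard {U : Type*} [Fintype U] [DecidableEq U] (G : Finset U) {t : ℕ}
    (ht : #G ≤ t) :
    #{T ∈ powersetCard t (univ : Finset U) | G ⊆ T} =
      (Fintype.card U - #G).choose (t - #G) := by
  rw [← card_compl, ← card_powersetCard]
  refine card_bij' (fun T _ => T \ G) (fun T _ => T ∪ G) ?_ ?_ ?_ ?_
  · intro T hT
    simp only [mem_filter, mem_powersetCard, subset_univ, true_and] at hT ⊢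
    refine ⟨fun x hx => mem_compl.2 (mem_sdiff.1 hx).2, ?_⟩
    rw [card_sdiff_of_subset hT.2, hT.1]
  · intro T hT
    simp only [mem_filter, mem_powersetCard, subset_univ, true_and] at hT ⊢
    have hdisj : Disjoint T G := disjoint_left.2 fun x hx => mem_compl.1 (hT.1 hx)
    refine ⟨?_, subset_union_right⟩
    rw [card_union_of_disjoint hdisj, hT.2]
    omega
  · intro T hT
    exact sdiff_union_of_subset (mem_filter.1 hT).2
  · intro T hT
    have hdisj : Disjoint T G :=
      disjoint_left.2 fun x hx => mem_compl.1 ((mem_powersetCard.1 hT).1 hx)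
    exact union_sdiff_cancel_right hdisj

/-- A labelling of the packets of a file by the `t`-subsets of the users. -/
noncomputable def packetLabel (U : Type*) [Fintype U] (t : ℕ) :
    Fin ((Fintype.card U).choose t) ≃ powersetCard t (univ : Finset U) :=
  (Fintype.equivFinOfCardEq (by simp)).symm

/-- Placement by a property of labels stores the same number of packets of every file. -/
theorem card_filter_label {U : Type*} [Fintype U] (N t : ℕ) (p : Finset U → Prop)
    [DecidablePred p] :
    #{q : Fin N × Fin ((Fintype.card U).choose t) | p (packetLabel U t q.2)} =
      N * #{T ∈ powersetCard t (univ : Finset U) | p T} := by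
  have h : ({q : Fin N × Fin ((Fintype.card U).choose t) | p (packetLabel U t q.2)} : Finset _) =
      univ ×ˢ ({j | p (packetLabel U t j)} : Finset _) := by
    ext q
    simp
  rw [h, card_product, card_univ, Fintype.card_fin]
  congr 1
  refine card_bij (fun j _ => (packetLabel U t j : Finset U)) ?_ ?_ ?_
  · intro j hj
    exact mem_filter.2 ⟨(packetLabel U t j).2, (mem_filter.1 hj).2⟩
  · intro i _ j _ hij
    exact (packetLabel U t).injective (Subtype.ext hij)
  · intro T hT
    obtain ⟨hT, hp⟩ := mem_filter.1 hT
    refine ⟨(packetLabel U t).symm ⟨T, hT⟩, ?_, ?_⟩ <;> simp [hp]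

/-- The users attached to a mirror site. -/
def site (K₁ K₂ : ℕ) (k : Fin K₁) : Finset (Fin K₁ × Fin K₂) := {k} ×ˢ univ

theorem card_site (K₁ K₂ : ℕ) (k : Fin K₁) : #(site K₁ K₂ k) = K₂ := by simp [site]

/-- The number of subpackets per file in the scheme that places packets by `t`-subsets of users. -/
abbrev subpackets (K₁ K₂ t : ℕ) : ℕ := (Fintype.card (Fin K₁ × Fin K₂)).choose t

/-- A packet is stored by a mirror site if its label contains all users of the site. -/
noncomputable def mirrorPlacement (K₁ K₂ N t : ℕ) (k : Fin K₁) :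
    Finset (Fin N × Fin (subpackets K₁ K₂ t)) :=
  {q | site K₁ K₂ k ⊆ (packetLabel (Fin K₁ × Fin K₂) t q.2 : Finset (Fin K₁ × Fin K₂))}

/-- A packet is stored by a user if its label contains the user, unless the mirror site of the
user stores it. -/
noncomputable def userPlacement (K₁ K₂ N t : ℕ) (u : Fin K₁ × Fin K₂) :
    Finset (Fin N × Fin (subpackets K₁ K₂ t)) :=
  {q | u ∈ (packetLabel (Fin K₁ × Fin K₂) t q.2 : Finset (Fin K₁ × Fin K₂)) ∧
    ¬ site K₁ K₂ u.1 ⊆ (packetLabel (Fin K₁ × Fin K₂) t q.2 : Finset (Fin K₁ × Fin K₂))}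

theorem card_mirrorPlacement (K₁ K₂ N : ℕ) {t : ℕ} (ht : K₂ ≤ t) (k : Fin K₁) :
    #(mirrorPlacement K₁ K₂ N t k) = N * (K₁ * K₂ - K₂).choose (t - K₂) := by
  rw [mirrorPlacement, card_filter_label (p := fun T => site K₁ K₂ k ⊆ T),
    card_superset_powersetCard _ (by rwa [card_site]), card_site]
  simp

/-- The labels containing `u` split according to whether they contain its whole site. The additive
form avoids truncated subtraction. -/
theorem card_userPlacement_add (K₁ K₂ N : ℕ) {t : ℕ} (ht0 : 0 < t) (ht : K₂ ≤ t)
    (u : Fin K₁ × Fin K₂) :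
    #(userPlacement K₁ K₂ N t u) + N * (K₁ * K₂ - K₂).choose (t - K₂) =
      N * (K₁ * K₂ - 1).choose (t - 1) := by
  have hu : #{T ∈ powersetCard t (univ : Finset (Fin K₁ × Fin K₂)) | {u} ⊆ T} =
      (K₁ * K₂ - 1).choose (t - 1) := by
    rw [card_superset_powersetCard _ (by rwa [card_singleton])]
    simp
  rw [← card_mirrorPlacement K₁ K₂ N ht u.1, mirrorPlacement, userPlacement,
    card_filter_label (p := fun T => site K₁ K₂ u.1 ⊆ T),
    card_filter_label (p := fun T => u ∈ T ∧ ¬ site K₁ K₂ u.1 ⊆ T), ← mul_add, ← hu,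
    ← card_filter_add_card_filter_not (s := {T ∈ powersetCard t univ | {u} ⊆ T})
      (fun T => site K₁ K₂ u.1 ⊆ T), filter_filter, filter_filter, add_comm]
  congr 3
  · ext T
    have : site K₁ K₂ u.1 ⊆ T → u ∈ T := fun h => h (by simp [site])
    simp only [mem_filter, singleton_subset_iff]
    tauto
  · simp only [singleton_subset_iff]

/-- The server's coded multicast messages: for every `(t + 1)`-subset `A` of the users, the sum
over `u ∈ A` of the packet labelled `A \ {u}` of the file requested by `u`. -/
noncomputable def multicast (K₁ K₂ N t b : ℕ) (d : Demand K₁ K₂ N)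
    (W : Library N (subpackets K₁ K₂ t) b) : Fin (subpackets K₁ K₂ (t + 1)) → Packet b :=
  fun i => ∑ u ∈ ((packetLabel (Fin K₁ × Fin K₂) (t + 1) i :
    Finset (Fin K₁ × Fin K₂))).attach,
    W (d u, (packetLabel (Fin K₁ × Fin K₂) t).symm
      ⟨(packetLabel (Fin K₁ × Fin K₂) (t + 1) i : Finset (Fin K₁ × Fin K₂)).erase u,
        mem_powersetCard.2 ⟨subset_univ _, by
          rw [card_erase_of_mem u.2,
            (mem_powersetCard.1 (packetLabel (Fin K₁ × Fin K₂) (t + 1) i).2).2,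
            Nat.add_sub_cancel]⟩⟩)

/-- The hierarchical coded caching scheme. -/
noncomputable def hierScheme (K₁ K₂ N t b : ℕ) : Scheme K₁ K₂ N (subpackets K₁ K₂ t) b :=
  Scheme.forwarding (mirrorPlacement K₁ K₂ N t) (userPlacement K₁ K₂ N t)
    (subpackets K₁ K₂ (t + 1)) (multicast K₁ K₂ N t b)

/-- A missing packet labelled `T` is the only summand unknown to `u` in the multicast for `insert u
T`, since every other label there contains `u`. -/
theorem hierScheme_serves (K₁ K₂ N t b : ℕ) (d : Demand K₁ K₂ N) :
    (hierScheme K₁ K₂ N t b).Serves d := by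
  refine Scheme.forwarding_serves _ _ _ _ d fun u W W' hX hcache j => ?_
  have hknown : ∀ q : Fin N × Fin (subpackets K₁ K₂ t),
      u ∈ (packetLabel (Fin K₁ × Fin K₂) t q.2 : Finset (Fin K₁ × Fin K₂)) → W q = W' q := by
    intro q hq
    refine hcache q (mem_union.2 ?_)
    by_cases h : site K₁ K₂ u.1 ⊆
        (packetLabel (Fin K₁ × Fin K₂) t q.2 : Finset (Fin K₁ × Fin K₂))
    · exact Or.inl (mem_filter.2 ⟨mem_univ _, h⟩)
    · exact Or.inr (mem_filter.2 ⟨mem_univ _, hq, h⟩)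
  by_cases hu : u ∈ (packetLabel (Fin K₁ × Fin K₂) t j : Finset (Fin K₁ × Fin K₂))
  · exact hknown _ hu
  obtain ⟨A, hA⟩ : ∃ A, A = insert u
    (packetLabel (Fin K₁ × Fin K₂) t j : Finset (Fin K₁ × Fin K₂)) := ⟨_, rfl⟩
  have hAcard : A ∈ powersetCard (t + 1) (univ : Finset (Fin K₁ × Fin K₂)) := by
    rw [mem_powersetCard, hA, card_insert_of_notMem hu,
      (mem_powersetCard.1 (packetLabel (Fin K₁ × Fin K₂) t j).2).2]
    exact ⟨subset_univ _, rfl⟩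
  obtain ⟨i, hi⟩ := (packetLabel (Fin K₁ × Fin K₂) (t + 1)).surjective ⟨A, hAcard⟩
  have hiA : (packetLabel (Fin K₁ × Fin K₂) (t + 1) i : Finset (Fin K₁ × Fin K₂)) = A := by
    rw [hi]
  have hui : u ∈ (packetLabel (Fin K₁ × Fin K₂) (t + 1) i : Finset (Fin K₁ × Fin K₂)) := by
    rw [hiA, hA]
    exact mem_insert_self _ _
  have hXi := congrFun hX i
  rw [multicast, multicast, ← add_sum_erase _ _ (mem_attach _ ⟨u, hui⟩),
    ← add_sum_erase _ _ (mem_attach _ ⟨u, hui⟩)] at hXi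
  have hrest := sum_congr (rfl : (attach _).erase (⟨u, hui⟩ : {x // x ∈
      (packetLabel (Fin K₁ × Fin K₂) (t + 1) i : Finset (Fin K₁ × Fin K₂))}) = _)
    fun v hv => hknown (d v, (packetLabel (Fin K₁ × Fin K₂) t).symm
      ⟨(packetLabel (Fin K₁ × Fin K₂) (t + 1) i : Finset (Fin K₁ × Fin K₂)).erase v,
        mem_powersetCard.2 ⟨subset_univ _, by
          rw [card_erase_of_mem v.2,
            (mem_powersetCard.1 (packetLabel (Fin K₁ × Fin K₂) (t + 1) i).2).2,
            Nat.add_sub_cancel]⟩⟩) (by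
      simp only [Equiv.apply_symm_apply, mem_erase]
      exact ⟨fun h => (mem_erase.1 hv).1 (Subtype.ext h.symm), hui⟩)
  rw [hrest] at hXi
  have hmain := add_right_cancel hXi
  have hlabel : ∀ h, (packetLabel (Fin K₁ × Fin K₂) t).symm
      ⟨(packetLabel (Fin K₁ × Fin K₂) (t + 1) i : Finset (Fin K₁ × Fin K₂)).erase u, h⟩ = j := by
    intro h
    rw [Equiv.symm_apply_eq]
    refine Subtype.ext ?_
    change Finset.erase _ _ = _
    rw [hiA, hA, erase_insert hu]
  simpa only [hlabel] using hmain

end HierCaching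

/-! ### Optimality at the given memory sizes -/

theorem corollary1 (K₁ K₂ t N : ℕ) (hK₁ : 0 < K₁) (hK₂ : 0 < K₂)
    (ht : K₂ < t) (ht' : t < K₁ * K₂) (hN : K₁ * K₂ ≤ N) (M₁ M₂ : ℝ)
    (hM₁ : M₁ / (N : ℝ) =
      ((K₁ * K₂ - K₂).choose (t - K₂) : ℝ) / ((K₁ * K₂).choose t : ℝ))
    (hM₂ : M₂ / (N : ℝ) = (t : ℝ) / ((K₁ : ℝ) * (K₂ : ℝ)) -
      ((K₁ * K₂ - K₂).choose (t - K₂) : ℝ) / ((K₁ * K₂).choose t : ℝ))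
    (D : Set (HierCaching.Demand K₁ K₂ N))
    (hD : ∀ d : HierCaching.Demand K₁ K₂ N, Function.Injective d → d ∈ D) :
    IsLeast (⋃ B : ℕ, HierCaching.firstLayerLoads K₁ K₂ N M₁ M₂ D B)
        (((K₁ : ℝ) * (K₂ : ℝ) - (t : ℝ)) / ((t : ℝ) + 1)) ∧
      HierCaching.optimalFirstLayerLoad K₁ K₂ N M₁ M₂ D =
        ((K₁ : ℝ) * (K₂ : ℝ) * (1 - (M₁ + M₂) / (N : ℝ))) /
          ((K₁ : ℝ) * (K₂ : ℝ) * ((M₁ + M₂) / (N : ℝ)) + 1) ∧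
      ∀ B : ℕ, 0 < B → (K₁ * K₂).choose t ∣ B →
        IsLeast (HierCaching.firstLayerLoads K₁ K₂ N M₁ M₂ D B)
          (((K₁ : ℝ) * (K₂ : ℝ) - (t : ℝ)) / ((t : ℝ) + 1)) := by
  have hK : 0 < K₁ * K₂ := Nat.mul_pos hK₁ hK₂
  have hN0 : (N : ℝ) ≠ 0 := Nat.cast_ne_zero.2 (hK.trans_le hN).ne'
  have hKr : (K₁ : ℝ) * K₂ ≠ 0 := by exact_mod_cast hK.ne'
  have hC : 0 < (K₁ * K₂).choose t := Nat.choose_pos ht'.le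
  have hCr : ((K₁ * K₂).choose t : ℝ) ≠ 0 := Nat.cast_ne_zero.2 hC.ne'
  have hF : HierCaching.subpackets K₁ K₂ t = (K₁ * K₂).choose t := by
    simp [HierCaching.subpackets]
  have hF' : HierCaching.subpackets K₁ K₂ (t + 1) = (K₁ * K₂).choose (t + 1) := by
    simp [HierCaching.subpackets]
  have hMsum : (M₁ + M₂) / (N : ℝ) = t / ((K₁ : ℝ) * K₂) := by
    rw [add_div, hM₁, hM₂]
    ring
  have hlb : ∀ B, ((K₁ : ℝ) * K₂ - t) / ((t : ℝ) + 1) ∈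
      lowerBounds (HierCaching.firstLayerLoads K₁ K₂ N M₁ M₂ D B) := by
    rintro B R ⟨F, b, hF, hb, -, c, hmem, hserve, hload⟩
    have hFr : (0 : ℝ) < F := Nat.cast_pos.2 hF
    refine c.load_ge hb hF hK hN (Nat.cast_nonneg t) ?_ (fun d hd => hserve d (hD d hd)) ?_
    · intro u
      rw [← hMsum]
      have hle : ((c.reachable u).card : ℝ) ≤ (c.mirrorCache u.1).card + (c.userCache u).card := by
        exact_mod_cast Finset.card_union_le _ _
      have h1 := hmem.1 u.1
      have h2 := hmem.2 u
      have h3 : (M₁ + M₂) / (N : ℝ) * (N * F) = M₁ * F + M₂ * F := by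
        field_simp
      linarith
    · intro d hd
      rw [← div_le_iff₀ hFr]
      exact hload.2 ⟨d, hD d hd, rfl⟩
  have hattain : ∀ B, 0 < B → (K₁ * K₂).choose t ∣ B → ((K₁ : ℝ) * K₂ - t) / ((t : ℝ) + 1) ∈
      HierCaching.firstLayerLoads K₁ K₂ N M₁ M₂ D B := by
    rintro B hB ⟨b, rfl⟩
    refine ⟨HierCaching.subpackets K₁ K₂ t, b, hF ▸ hC, Nat.pos_of_mul_pos_left hB, by rw [hF],
      HierCaching.hierScheme K₁ K₂ N t b, ⟨fun k => ?_, fun u => ?_⟩,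
      fun d _ => HierCaching.hierScheme_serves K₁ K₂ N t b d, ?_⟩
    · change ((HierCaching.mirrorPlacement K₁ K₂ N t k).card : ℝ) ≤ _
      rw [HierCaching.card_mirrorPlacement K₁ K₂ N ht.le k, hF]
      rw [div_eq_div_iff hN0 hCr] at hM₁
      push_cast
      linarith
    · change ((HierCaching.userPlacement K₁ K₂ N t u).card : ℝ) ≤ _
      have hcard := HierCaching.card_userPlacement_add K₁ K₂ N (hK₂.trans ht) ht.le u
      have hpascal : K₁ * K₂ * (K₁ * K₂ - 1).choose (t - 1) = (K₁ * K₂).choose t * t := by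
        have := Nat.add_one_mul_choose_eq (K₁ * K₂ - 1) (t - 1)
        rwa [Nat.sub_add_cancel hK, Nat.sub_add_cancel (hK₂.trans ht)] at this
      have hcard' : ((HierCaching.userPlacement K₁ K₂ N t u).card : ℝ) =
          N * ((K₁ * K₂ - 1).choose (t - 1) : ℝ) -
            N * ((K₁ * K₂ - K₂).choose (t - K₂) : ℝ) := by
        rw [eq_sub_iff_add_eq]
        exact_mod_cast hcard
      have hpascal' : ((K₁ * K₂ - 1).choose (t - 1) : ℝ) =
          ((K₁ * K₂).choose t : ℝ) * t / ((K₁ : ℝ) * K₂) := by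
        rw [eq_div_iff hKr, mul_comm]
        exact_mod_cast hpascal
      have hM₂' : M₂ = N * ((t : ℝ) / ((K₁ : ℝ) * (K₂ : ℝ)) -
          ((K₁ * K₂ - K₂).choose (t - K₂) : ℝ) / ((K₁ * K₂).choose t : ℝ)) := by
        rw [← hM₂, mul_div_cancel₀ _ hN0]
      rw [hcard', hpascal', hF, hM₂']
      refine le_of_eq ?_
      field_simp
    · have hratio : (HierCaching.subpackets K₁ K₂ (t + 1) : ℝ) /
          (HierCaching.subpackets K₁ K₂ t : ℝ) = ((K₁ : ℝ) * K₂ - t) / ((t : ℝ) + 1) := by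
        rw [hF, hF', div_eq_div_iff hCr (by positivity)]
        have := Nat.choose_succ_right_eq (K₁ * K₂) t
        rw [← Nat.cast_mul, ← Nat.cast_sub ht'.le]
        rw [mul_comm ((K₁ * K₂ - t : ℕ) : ℝ)]
        exact_mod_cast this
      obtain ⟨d₀⟩ : Nonempty (Fin K₁ × Fin K₂ ↪ Fin N) :=
        Function.Embedding.nonempty_of_card_le (by simpa using hN)
      refine ⟨⟨d₀, hD d₀ d₀.injective, hratio⟩, ?_⟩
      rintro _ ⟨d, -, rfl⟩
      exact hratio.le
  have hleast : IsLeast (⋃ B : ℕ, HierCaching.firstLayerLoads K₁ K₂ N M₁ M₂ D B)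
      (((K₁ : ℝ) * (K₂ : ℝ) - (t : ℝ)) / ((t : ℝ) + 1)) := by
    -- The file size is the number of packets, so packets are single bits.
    refine ⟨Set.mem_iUnion.2 ⟨_, hattain _ hC dvd_rfl⟩, fun R hR => ?_⟩
    obtain ⟨B, hB⟩ := Set.mem_iUnion.1 hR
    exact hlb B hB
  refine ⟨hleast, ?_, fun B hB hdvd => ⟨hattain B hB hdvd, hlb B⟩⟩
  rw [HierCaching.optimalFirstLayerLoad, hleast.csInf_eq, hMsum, mul_sub, mul_one,
    mul_div_cancel₀ _ hKr]
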